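/- Let $\mathbb T=\mathbb R/2\pi\mathbb Z$ with Lebesgue measure $|\cdot|$ (so $|\mathbb T|=2\pi$), and for $m\ge 0$ let $\mathcal F_m$ be the set of trigonometric polynomials $\frac{a_0}{2}+\sum_{k=1}^m(a_k\cos kt+b_k\sin kt)$ with real coefficients. Fix $n\ge 1$. For $y>1$ put $$\sigma_n(y)=\inf\bigl\{\,|\{t\in\mathbb T:\ |y\cos nt+f_{n-1}(t)|\ge 1\}|\ :\ f_{n-1}\in\mathcal F_{n-1}\bigr\},$$ and for $0<\alpha<\pi$ put $$U_n(2\alpha)=\inf_{Q}\ \inf_{f_{n-1}\in\mathcal F_{n-1}}\ \max_{t\in Q}|\cos nt-f_{n-1}(t)|,$$ where $Q$ runs over all compact subsets of $\mathbb T$ of measure $|Q|=2\alpha$. These two extremal problems are dual to each other in the following sense: for every $y>1$, the number $\alpha$ determined by $2\alpha=2\pi-\sigma_n(y)$ satisfies $0<\alpha<\pi$, and $$U_n(2\alpha)=\frac1y ;$$ moreover, every $\alpha\in(0,\pi)$ is of the form $2\alpha=2\pi-\sigma_n(y)$ for some $y>1$. -/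

import Mathlib

/-- The period `2π` is positive; this activates the Lebesgue measure of `AddCircle (2 * π)`. -/
instance factTwoPiPos : Fact (0 < 2 * Real.pi) := ⟨Real.two_pi_pos⟩

/-- The torus `ℝ / 2πℤ`; its `volume` is Lebesgue measure, of total mass `2π`. -/
abbrev Torus : Type := AddCircle (2 * Real.pi)

/-- The real trigonometric polynomial
`a₀ / 2 + ∑_{k=1}^n (a_k cos kt + b_k sin kt)`, as a (`2π`-periodic) function on the line. -/
noncomputable def trigPoly (n : ℕ) (a b : ℕ → ℝ) (t : ℝ) : ℝ :=
  a 0 / 2 + ∑ k ∈ Finset.Icc 1 n, (a k * Real.cos (k * t) + b k * Real.sin (k * t))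

/-- The set of real trigonometric polynomials of order `n`. -/
def trigPolys (n : ℕ) : Set (ℝ → ℝ) :=
  {f | ∃ a b : ℕ → ℝ, f = trigPoly n a b}

/-- The set of functions `y cos nt + g(t)`, where `g` is a trigonometric polynomial of
order `n - 1` (used for `n ≥ 1`). -/
def trigPolysLeading (n : ℕ) (y : ℝ) : Set (ℝ → ℝ) :=
  {f | ∃ g ∈ trigPolys (n - 1), f = fun t => y * Real.cos (n * t) + g t}

/-- The Lebesgue measure of the set of points of the torus at which `|f| ≥ 1`, for a
`2π`-periodic function `f`. -/
noncomputable def levelMeasure (f : ℝ → ℝ) : ℝ :=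
  MeasureTheory.volume.real {x : Torus | ∃ t : ℝ, (t : Torus) = x ∧ 1 ≤ |f t|}

/-- The least deviation in measure, `σ_n(y)`: the infimum of the measure of `{|f| ≥ 1}` over all
`f(t) = y cos nt + g(t)` with `g` of order `n - 1`. -/
noncomputable def sigmaDev (n : ℕ) (y : ℝ) : ℝ :=
  sInf {s : ℝ | ∃ f ∈ trigPolysLeading n y, s = levelMeasure f}

/-- The uniform norm, on a compact subset `Q` of the torus, of a `2π`-periodic continuous
function `f`. -/
noncomputable def supNormOn (Q : Set Torus) (f : ℝ → ℝ) : ℝ :=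
  sSup {r : ℝ | ∃ t : ℝ, (t : Torus) ∈ Q ∧ r = |f t|}

/-- The best uniform approximation `U_n(Q)` of `cos nt` on `Q` by trigonometric polynomials of
order `n - 1`. -/
noncomputable def bestApprox (n : ℕ) (Q : Set Torus) : ℝ :=
  sInf {r : ℝ | ∃ g ∈ trigPolys (n - 1), r = supNormOn Q (fun t => Real.cos (n * t) - g t)}

/-- The least value of `U_n(Q)` over all compact subsets `Q` of the torus of measure `s`. -/
noncomputable def leastUniformDev (n : ℕ) (s : ℝ) : ℝ :=
  sInf {r : ℝ | ∃ Q : Set Torus, IsCompact Q ∧ MeasureTheory.volume.real Q = s ∧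
    r = bestApprox n Q}

/-! Scaling links the two problems: |y cos nt + g| ≤ 1 on Q means that -g/y approximates cos nt on Q
within 1/y. The set {|f| ≤ 1} of an extremal f for σ(y) has measure 2π - σ(y), so U ≤ 1/y. A better
approximation on a set of that measure would give σ(y') ≤ σ(y) for some y' > y, against strict
monotonicity of σ (`leastSuperlevel_strictMono`). Every value in (0, 2π) is attained by taking the
largest leading coefficient compatible with it, which exists by compactness
(`isCompact_superlevel_le`). Apart from elementary properties of cos nt, only two facts about
trigonometric polynomials matter: |y| ≤ ‖y cos nt + g‖, and nonzero ones have null zero sets.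
`IsLeadingTerm` isolates these. -/

open MeasureTheory Filter Topology
open scoped ContDiff

set_option linter.unusedSectionVars false

/-! ### Measure of superlevel sets -/

section LevelSets

variable {X : Type*} [TopologicalSpace X] [CompactSpace X] [MeasurableSpace X] [BorelSpace X]

/-- The measure of the set where `|f|` is at least `c`. -/
noncomputable def superlevel (μ : Measure X) (c : ℝ) (f : C(X, ℝ)) : ℝ :=
  μ.real {x | c ≤ |f x|}

/-- The measure of `{c ≤ |f|}` is continuous in `(c, f)` where `{|f| = c}` is a null set. -/
theorem continuousAt_superlevel (μ : Measure X) [IsFiniteMeasure μ] {c : ℝ} {f : C(X, ℝ)}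
    (h : μ {x | |f x| = c} = 0) :
    ContinuousAt (fun p : ℝ × C(X, ℝ) => superlevel μ p.1 p.2) (c, f) := by
  have key : Tendsto (fun p : ℝ × C(X, ℝ) => μ {x | p.1 ≤ |p.2 x|}) (𝓝 (c, f))
      (𝓝 (μ {x | c ≤ |f x|})) := by
    refine tendsto_measure_of_ae_tendsto_indicator_of_isFiniteMeasure _ ?_ ?_ ?_
    · exact (isClosed_le continuous_const (by fun_prop)).measurableSet
    · exact fun p => (isClosed_le continuous_const (by fun_prop)).measurableSet
    · have h' : ∀ᵐ x ∂μ, |f x| ≠ c := by simpa [ae_iff] using h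
      filter_upwards [h'] with x hx
      have h1 : Tendsto (fun p : ℝ × C(X, ℝ) => p.1) (𝓝 (c, f)) (𝓝 c) :=
        continuous_fst.tendsto' _ _ rfl
      have h2 : Tendsto (fun p : ℝ × C(X, ℝ) => |p.2 x|) (𝓝 (c, f)) (𝓝 |f x|) := by
        have : Continuous (fun p : ℝ × C(X, ℝ) => |p.2 x|) :=
          ((continuous_eval_const x).comp continuous_snd).abs
        exact this.tendsto' _ _ rfl
      rcases lt_or_gt_of_ne hx with hlt | hgt
      · filter_upwards [h2.eventually_lt h1 hlt] with p hp
        exact ⟨fun h => absurd hp h.not_gt, fun h => absurd hlt h.not_gt⟩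
      · filter_upwards [h1.eventually_lt h2 hgt] with p hp
        exact ⟨fun _ => hgt.le, fun _ => hp.le⟩
  exact (ENNReal.tendsto_toReal (measure_ne_top μ _)).comp key

theorem superlevel_smul (μ : Measure X) {r : ℝ} (hr : 0 < r) (c : ℝ) (f : C(X, ℝ)) :
    superlevel μ (r * c) (r • f) = superlevel μ c f := by
  simp [superlevel, abs_mul, abs_of_pos hr, mul_le_mul_iff_right₀ hr]

theorem superlevel_anti (μ : Measure X) [IsFiniteMeasure μ] {c d : ℝ} (h : c ≤ d) (f : C(X, ℝ)) :
    superlevel μ d f ≤ superlevel μ c f :=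
  measureReal_mono fun _ hx => h.trans hx

theorem superlevel_nonneg (μ : Measure X) (c : ℝ) (f : C(X, ℝ)) : 0 ≤ superlevel μ c f :=
  measureReal_nonneg

theorem superlevel_zero (μ : Measure X) (f : C(X, ℝ)) :
    superlevel μ 0 f = μ.real Set.univ := by
  simp [superlevel]

/-- If `|f|` attains a value in an open interval `(c, d)`, then the level set measure drops
strictly from `c` to `d`. -/
theorem superlevel_lt (μ : Measure X) [IsFiniteMeasure μ] [μ.IsOpenPosMeasure] {c d : ℝ}
    {f : C(X, ℝ)} {x : X} (hc : c < |f x|) (hd : |f x| < d) :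
    superlevel μ d f < superlevel μ c f := by
  have hU : IsOpen {x | c < |f x| ∧ |f x| < d} :=
    (isOpen_lt continuous_const f.continuous.abs).inter
      (isOpen_lt f.continuous.abs continuous_const)
  have hpos : 0 < μ.real {x | c < |f x| ∧ |f x| < d} :=
    ENNReal.toReal_pos (hU.measure_pos μ ⟨x, hc, hd⟩).ne' (measure_ne_top _ _)
  have hdisj : Disjoint {x | d ≤ |f x|} {x | c < |f x| ∧ |f x| < d} :=
    Set.disjoint_left.2 fun z hz hz' => hz'.2.not_ge hz
  have hsub : {x | d ≤ |f x|} ∪ {x | c < |f x| ∧ |f x| < d} ⊆ {x | c ≤ |f x|} := by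
    rintro z (hz | hz)
    · exact (hc.trans hd).le.trans hz
    · exact hz.1.le
  have := measureReal_mono (μ := μ) hsub
  rw [measureReal_union hdisj hU.measurableSet] at this
  unfold superlevel
  linarith

theorem superlevel_add_sublevel (μ : Measure X) [IsFiniteMeasure μ] {c : ℝ} {f : C(X, ℝ)}
    (h : μ {x | |f x| = c} = 0) :
    superlevel μ c f + μ.real {x | |f x| ≤ c} = μ.real Set.univ := by
  have h1 : μ.real {x | |f x| ≤ c} = μ.real {x | c ≤ |f x|}ᶜ := by
    apply measureReal_congr
    have h' : ∀ᵐ x ∂μ, |f x| ≠ c := by simpa [ae_iff] using h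
    filter_upwards [h'] with x hx
    apply propext
    change |f x| ≤ c ↔ ¬ c ≤ |f x|
    rw [not_le]
    exact ⟨fun h => lt_of_le_of_ne h hx, le_of_lt⟩
  rw [h1, superlevel, measureReal_add_measureReal_compl]
  exact (isClosed_le continuous_const (by fun_prop)).measurableSet

/-! ### Abstract leading terms and compactness -/

/-- The subspace `V` and the function `e` behave like the trigonometric polynomials of order
`n - 1` and `cos nt`. -/
structure IsLeadingTerm (μ : Measure X) (V : Submodule ℝ C(X, ℝ)) (e : C(X, ℝ)) : Prop where
  one_mem : 1 ∈ V
  abs_le_one : ∀ x, |e x| ≤ 1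
  exists_zero : ∃ x, e x = 0
  abs_coeff_le : ∀ y : ℝ, ∀ g ∈ V, |y| ≤ ‖y • e + g‖
  null_zeros : ∀ y : ℝ, ∀ g ∈ V, y • e + g ≠ 0 → μ {x | (y • e + g) x = 0} = 0

/-- The infimum of the measure of `{1 ≤ |f|}` over `f ∈ y e + V`. -/
noncomputable def leastSuperlevel (μ : Measure X) (V : Submodule ℝ C(X, ℝ)) (e : C(X, ℝ))
    (y : ℝ) : ℝ :=
  sInf {s | ∃ g ∈ V, s = superlevel μ 1 (y • e + g)}

theorem leastSuperlevel_le (μ : Measure X) {V : Submodule ℝ C(X, ℝ)} (e : C(X, ℝ)) (y : ℝ)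
    {g : C(X, ℝ)} (hg : g ∈ V) : leastSuperlevel μ V e y ≤ superlevel μ 1 (y • e + g) :=
  csInf_le ⟨0, by rintro _ ⟨g, -, rfl⟩; exact superlevel_nonneg _ _ _⟩ ⟨g, hg, rfl⟩

namespace IsLeadingTerm

variable {μ : Measure X} {V : Submodule ℝ C(X, ℝ)} {e : C(X, ℝ)}

/-- Constants lie in `V`, so a level set is a zero set of another element of y e + V, nonzero by the
coefficient bound. -/
theorem null_level (h : IsLeadingTerm μ V e) {y : ℝ} (hy : y ≠ 0) {g : C(X, ℝ)} (hg : g ∈ V)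
    (c : ℝ) : μ {x | |(y • e + g) x| = c} = 0 := by
  have aux : ∀ d : ℝ, μ {x | (y • e + g) x = d} = 0 := by
    intro d
    have hV : g + (-d) • (1 : C(X, ℝ)) ∈ V := V.add_mem hg (V.smul_mem _ h.one_mem)
    have hne : y • e + (g + (-d) • (1 : C(X, ℝ))) ≠ 0 := by
      intro h0
      have := h.abs_coeff_le y _ hV
      rw [h0, norm_zero] at this
      exact hy (abs_nonpos_iff.1 this)
    refine measure_mono_null (fun x hx => ?_) (h.null_zeros y _ hV hne)
    simp only [Set.mem_ofPred_eq, ContinuousMap.add_apply, ContinuousMap.smul_apply,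
      ContinuousMap.one_apply, smul_eq_mul] at hx ⊢
    linarith
  refine measure_mono_null (fun x hx => ?_) (measure_union_null (aux c) (aux (-c)))
  exact eq_or_eq_neg_of_abs_eq hx

theorem continuousAt_superlevel_comb [IsFiniteMeasure μ] (h : IsLeadingTerm μ V e) {p : ℝ × V}
    (hp : p.1 ≠ 0) :
    ContinuousAt (fun p : ℝ × V => superlevel μ 1 (p.1 • e + (p.2 : C(X, ℝ)))) p := by
  have hcont : Continuous fun z : ℝ × V =>
      ((1, z.1 • e + (z.2 : C(X, ℝ))) : ℝ × C(X, ℝ)) := by fun_prop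
  exact ContinuousAt.comp (f := fun z : ℝ × V => ((1, z.1 • e + (z.2 : C(X, ℝ))) : ℝ × C(X, ℝ)))
    (x := p) (continuousAt_superlevel μ (h.null_level hp p.2.2 1)) hcont.continuousAt

variable [FiniteDimensional ℝ V]

theorem isCompact_norm_le (h : IsLeadingTerm μ V e) (R : ℝ) :
    IsCompact {p : ℝ × V | ‖p.1 • e + (p.2 : C(X, ℝ))‖ ≤ R} := by
  have := FiniteDimensional.proper ℝ V
  refine Metric.isCompact_of_isClosed_isBounded (isClosed_le (by fun_prop) continuous_const) ?_
  refine isBounded_iff_forall_norm_le.2 ⟨R + R * ‖e‖, ?_⟩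
  rintro ⟨y, g⟩ hp
  simp only [Set.mem_ofPred_eq] at hp
  have h1 : |y| ≤ R := (h.abs_coeff_le y g g.2).trans hp
  have h2 : ‖(g : C(X, ℝ))‖ ≤ R + |y| * ‖e‖ := by
    have := norm_sub_le (y • e + (g : C(X, ℝ))) (y • e)
    rw [add_sub_cancel_left, norm_smul, Real.norm_eq_abs] at this
    linarith
  have h3 : |y| * ‖e‖ ≤ R * ‖e‖ := by gcongr
  have h4 : 0 ≤ R * ‖e‖ := by positivity [(abs_nonneg y).trans h1]
  exact max_le (by rw [Real.norm_eq_abs]; linarith) (by change ‖(g : C(X, ℝ))‖ ≤ _; linarith)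

variable [IsFiniteMeasure μ]

/-- Functions whose superlevel set misses a set of measure `δ` are uniformly bounded. -/
theorem exists_norm_bound (h : IsLeadingTerm μ V e) {s : ℝ} (hs : s < μ.real Set.univ) :
    ∃ R, ∀ y : ℝ, ∀ g ∈ V, superlevel μ 1 (y • e + g) ≤ s → ‖y • e + g‖ ≤ R := by
  have hK : IsCompact {p : ℝ × V | ‖p.1 • e + (p.2 : C(X, ℝ))‖ = 1} :=
    (h.isCompact_norm_le 1).of_isClosed_subset (isClosed_eq (by fun_prop) continuous_const)
      fun p hp => le_of_eq hp
  -- At c = 0 the superlevel set is the whole space; null zero sets give continuity there, and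
  -- compactness of the unit sphere makes c uniform.
  have hev : ∀ᶠ c in 𝓝 (0 : ℝ), ∀ p ∈ {p : ℝ × V | ‖p.1 • e + (p.2 : C(X, ℝ))‖ = 1},
      s < superlevel μ c (p.1 • e + (p.2 : C(X, ℝ))) := by
    refine hK.eventually_forall_of_forall_eventually fun p hp => ?_
    have hne : p.1 • e + (p.2 : C(X, ℝ)) ≠ 0 := by
      intro h0
      simp only [Set.mem_ofPred_eq, h0, norm_zero] at hp
      exact zero_ne_one hp
    have hnull : μ {x | |(p.1 • e + (p.2 : C(X, ℝ))) x| = 0} = 0 := by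
      simpa only [abs_eq_zero] using h.null_zeros p.1 _ p.2.2 hne
    have hcont : Continuous fun z : ℝ × (ℝ × V) =>
        ((z.1, z.2.1 • e + (z.2.2 : C(X, ℝ))) : ℝ × C(X, ℝ)) := by fun_prop
    have ht := Tendsto.comp (continuousAt_superlevel μ hnull) (hcont.tendsto' (0, p) _ rfl)
    refine ht.eventually (lt_mem_nhds ?_)
    simpa [superlevel_zero] using hs
  obtain ⟨c, hc, hc0⟩ := ((hev.filter_mono nhdsWithin_le_nhds).and
    (self_mem_nhdsWithin : Set.Ioi (0 : ℝ) ∈ 𝓝[>] (0 : ℝ))).exists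
  have hc0 : 0 < c := hc0
  refine ⟨c⁻¹, fun y g hg hle => ?_⟩
  by_contra! hlt
  have hr : 0 < ‖y • e + g‖ := (inv_pos.2 hc0).trans hlt
  set r := ‖y • e + g‖ with hrdef
  have h1 := hc (r⁻¹ * y, ⟨r⁻¹ • g, V.smul_mem _ hg⟩) (by
    change ‖(r⁻¹ * y) • e + r⁻¹ • g‖ = 1
    rw [mul_smul, ← smul_add, norm_smul, ← hrdef, norm_inv, Real.norm_of_nonneg hr.le,
      inv_mul_cancel₀ hr.ne'])
  change s < superlevel μ c ((r⁻¹ * y) • e + r⁻¹ • g) at h1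
  rw [mul_smul, ← smul_add] at h1
  have h2 : superlevel μ c (r⁻¹ • (y • e + g)) ≤ superlevel μ (r⁻¹ * 1) (r⁻¹ • (y • e + g)) :=
    superlevel_anti μ (by rw [mul_one]; exact (inv_lt_of_inv_lt₀ hc0 hlt).le) _
  rw [superlevel_smul μ (inv_pos.2 hr)] at h2
  linarith

/-- The bound y₀ ≤ y keeps away from y = 0, where a constant ±1 can break continuity of the measure.
-/
theorem isCompact_superlevel_le (h : IsLeadingTerm μ V e) {y₀ s : ℝ} (hy₀ : 0 < y₀)
    (hs : s < μ.real Set.univ) :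
    IsCompact {p : ℝ × V | y₀ ≤ p.1 ∧ superlevel μ 1 (p.1 • e + (p.2 : C(X, ℝ))) ≤ s} := by
  obtain ⟨R, hR⟩ := h.exists_norm_bound hs
  refine (h.isCompact_norm_le R).of_isClosed_subset ?_ fun p hp => hR _ _ p.2.2 hp.2
  have hco : ContinuousOn (fun p : ℝ × V => superlevel μ 1 (p.1 • e + (p.2 : C(X, ℝ))))
      {p | y₀ ≤ p.1} := by
    intro p hp
    have hp : y₀ ≤ p.1 := hp
    exact (h.continuousAt_superlevel_comb (hy₀.trans_le hp).ne').continuousWithinAt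
  exact hco.preimage_isClosed_of_isClosed (isClosed_le continuous_const continuous_fst) isClosed_Iic

end IsLeadingTerm
end LevelSets

/-! ### Extremal problem and duality -/

namespace IsLeadingTerm

variable {X : Type*} [TopologicalSpace X] [CompactSpace X] [MeasurableSpace X] [BorelSpace X]
  {μ : Measure X} {V : Submodule ℝ C(X, ℝ)} {e : C(X, ℝ)}
  [FiniteDimensional ℝ V] [IsFiniteMeasure μ]

theorem superlevel_self (h : IsLeadingTerm μ V e) :
    superlevel μ 1 ((1 : ℝ) • e + 0) = 0 := by
  have h0 := h.null_level one_ne_zero V.zero_mem 1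
  rw [superlevel, measureReal_def, measure_mono_null (fun x hx => ?_) h0, ENNReal.toReal_zero]
  have hx : 1 ≤ |((1 : ℝ) • e + 0) x| := hx
  change |((1 : ℝ) • e + 0) x| = 1
  refine le_antisymm ?_ hx
  simpa using h.abs_le_one x

variable [μ.IsOpenPosMeasure]

theorem superlevel_smul_lt (h : IsLeadingTerm μ V e) (y : ℝ) :
    superlevel μ 1 (y • e + 0) < μ.real Set.univ := by
  obtain ⟨x, hx⟩ := h.exists_zero
  have hx' : |(y • e + 0) x| = 0 := by simp [hx]
  exact (superlevel_lt μ (c := -1) (x := x) (by rw [hx']; norm_num) (by rw [hx']; norm_num)).trans_le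
    (measureReal_mono (Set.subset_univ _))

theorem leastSuperlevel_lt (h : IsLeadingTerm μ V e) (y : ℝ) :
    leastSuperlevel μ V e y < μ.real Set.univ :=
  (leastSuperlevel_le μ e y V.zero_mem).trans_lt (h.superlevel_smul_lt y)

/-- The least measure of the superlevel set is attained. -/
theorem exists_superlevel_eq (h : IsLeadingTerm μ V e) {y : ℝ} (hy : 0 < y) :
    ∃ g ∈ V, superlevel μ 1 (y • e + g) = leastSuperlevel μ V e y := by
  -- Competitors no better than g = 0 can be discarded, leaving a compact set.
  have hK := (h.isCompact_superlevel_le hy (h.superlevel_smul_lt y)).inter_right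
    (isClosed_eq continuous_fst continuous_const : IsClosed {p : ℝ × V | p.1 = y})
  obtain ⟨p, ⟨hp1, hp2⟩, hmin⟩ := hK.exists_isMinOn ⟨(y, 0), ⟨le_refl y, le_refl _⟩, rfl⟩
    (f := fun p : ℝ × V => superlevel μ 1 (p.1 • e + (p.2 : C(X, ℝ)))) (fun p hp =>
      (h.continuousAt_superlevel_comb (hy.trans_le hp.1.1).ne').continuousWithinAt)
  have hp2 : p.1 = y := hp2
  refine ⟨p.2, p.2.2, le_antisymm ?_ (leastSuperlevel_le μ e y p.2.2)⟩
  refine le_csInf ⟨_, 0, V.zero_mem, rfl⟩ ?_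
  rintro _ ⟨g, hg, rfl⟩
  rw [← hp2]
  rcases le_or_gt (superlevel μ 1 (y • e + g)) (superlevel μ 1 (y • e + 0)) with hle | hgt
  · have := isMinOn_iff.1 hmin (y, ⟨g, hg⟩) ⟨⟨le_refl y, hle⟩, rfl⟩
    rw [hp2]
    simpa [hp2] using this
  · rw [hp2]
    refine le_trans ?_ hgt.le
    have := hp1.2
    rwa [hp2] at this

/-- Shrinking an extremal f for z by y/z turns level 1 into level z/y for f. The measure drops
strictly, because |f| dips below 1, has norm at least z ≥ z/y, and so by connectedness meets (1,
z/y). -/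
theorem leastSuperlevel_strictMono [PreconnectedSpace X] (h : IsLeadingTerm μ V e) {y z : ℝ}
    (hy : 1 ≤ y) (hyz : y < z) : leastSuperlevel μ V e y < leastSuperlevel μ V e z := by
  have hy0 : 0 < y := one_pos.trans_le hy
  have hz0 : 0 < z := hy0.trans hyz
  obtain ⟨g, hg, hgz⟩ := h.exists_superlevel_eq hz0
  have hlt := h.leastSuperlevel_lt z
  rw [← hgz] at hlt ⊢
  set f := z • e + g with hf
  obtain ⟨x₁, hx₁⟩ : ∃ x, |f x| < 1 := by
    by_contra! hall
    have : {x | 1 ≤ |f x|} = Set.univ := Set.eq_univ_of_forall hall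
    rw [superlevel, this] at hlt
    exact lt_irrefl _ hlt
  have hr1 : 1 < z / y := (one_lt_div hy0).2 hyz
  have hrz : z / y ≤ z := div_le_self hz0.le hy
  obtain ⟨x₂, hx₂⟩ : ∃ x, (1 + z / y) / 2 ≤ |f x| := by
    by_contra! hall
    have hb : ‖f‖ ≤ (1 + z / y) / 2 :=
      (ContinuousMap.norm_le _ (by linarith)).2 fun x => (hall x).le
    have := h.abs_coeff_le z g hg
    rw [abs_of_pos hz0] at this
    linarith
  obtain ⟨x, hx⟩ := mem_range_of_exists_le_of_exists_ge (f.continuous.abs)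
    ⟨x₁, (by linarith : |f x₁| ≤ (1 + z / y) / 2)⟩ ⟨x₂, hx₂⟩
  have hx : |f x| = (1 + z / y) / 2 := hx
  have h1 : superlevel μ (z / y) f < superlevel μ 1 f :=
    superlevel_lt μ (x := x) (by linarith) (by linarith)
  refine lt_of_le_of_lt ?_ h1
  have h2 := superlevel_smul μ (div_pos hy0 hz0) (z / y) f
  rw [div_mul_div_cancel₀ hz0.ne', div_self hy0.ne', hf, smul_add, smul_smul,
    div_mul_cancel₀ _ hz0.ne', ← hf] at h2
  rw [← h2]
  exact leastSuperlevel_le μ e y (V.smul_mem _ hg)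

theorem leastSuperlevel_pos [PreconnectedSpace X] (h : IsLeadingTerm μ V e) {y : ℝ} (hy : 1 < y) :
    0 < leastSuperlevel μ V e y := by
  refine lt_of_le_of_lt ?_ (h.leastSuperlevel_strictMono le_rfl hy)
  refine Real.sInf_nonneg ?_
  rintro _ ⟨g, -, rfl⟩
  exact superlevel_nonneg _ _ _

/-- Every intermediate value is a least superlevel measure: take the largest admissible leading
coefficient. -/
theorem exists_leastSuperlevel_eq (h : IsLeadingTerm μ V e) {s : ℝ} (hs0 : 0 < s)
    (hs : s < μ.real Set.univ) : ∃ y, 1 < y ∧ leastSuperlevel μ V e y = s := by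
  obtain ⟨p, hp, hmax⟩ := (h.isCompact_superlevel_le one_pos hs).exists_isMaxOn
    ⟨(1, 0), le_refl (1 : ℝ), (h.superlevel_self.trans_le hs0.le :)⟩ continuousOn_fst
  have hp1 : 1 ≤ p.1 := hp.1
  -- A strict inequality would survive a small increase of the leading coefficient, against
  -- maximality.
  have hge : ∀ g ∈ V, s ≤ superlevel μ 1 (p.1 • e + g) := by
    intro g hg
    by_contra! hlt
    have hc := h.continuousAt_superlevel_comb (p := (p.1, ⟨g, hg⟩)) (one_pos.trans_le hp1).ne'
    have hc2 : Tendsto (fun y : ℝ => ((y, ⟨g, hg⟩) : ℝ × V)) (𝓝 p.1) (𝓝 (p.1, ⟨g, hg⟩)) :=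
      Continuous.tendsto' (by fun_prop) _ _ rfl
    have hev := (hc.tendsto.comp hc2).eventually (gt_mem_nhds hlt)
    obtain ⟨y, hy, hyp⟩ := ((hev.filter_mono nhdsWithin_le_nhds).and
      (self_mem_nhdsWithin : Set.Ioi p.1 ∈ 𝓝[>] p.1)).exists
    have hyp : p.1 < y := hyp
    have hy' : y ≤ p.1 := isMaxOn_iff.1 hmax (y, ⟨g, hg⟩) ⟨hp1.trans hyp.le, hy.le⟩
    exact hyp.not_ge hy'
  refine ⟨p.1, lt_of_le_of_ne hp1 fun h1 => ?_, le_antisymm ?_ ?_⟩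
  · have := hge 0 V.zero_mem
    rw [← h1, h.superlevel_self] at this
    exact hs0.not_ge this
  · exact (leastSuperlevel_le μ e _ p.2.2).trans hp.2
  · refine le_csInf ⟨_, 0, V.zero_mem, rfl⟩ ?_
    rintro _ ⟨g, hg, rfl⟩
    exact hge g hg

/-- A set of the critical measure on which `e` is approximated by `V` up to `1 / y`. -/
theorem exists_isCompact_approx (h : IsLeadingTerm μ V e) {y : ℝ} (hy : 0 < y) :
    ∃ Q : Set X, IsCompact Q ∧ μ.real Q = μ.real Set.univ - leastSuperlevel μ V e y ∧
      ∃ g ∈ V, ∀ x ∈ Q, |e x - g x| ≤ y⁻¹ := by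
  obtain ⟨g, hg, hgy⟩ := h.exists_superlevel_eq hy
  refine ⟨{x | |(y • e + g) x| ≤ 1},
    (isClosed_le (y • e + g).continuous.abs continuous_const).isCompact, ?_,
    (-y⁻¹) • g, V.smul_mem _ hg, fun x hx => ?_⟩
  · rw [← hgy, ← superlevel_add_sublevel μ (h.null_level hy.ne' hg 1)]
    ring
  · have hx : |(y • e + g) x| ≤ 1 := hx
    have : e x - ((-y⁻¹) • g) x = y⁻¹ * (y • e + g) x := by
      simp only [ContinuousMap.add_apply, ContinuousMap.smul_apply, smul_eq_mul]
      field_simp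
      ring
    rw [this, abs_mul, abs_of_pos (inv_pos.2 hy)]
    exact mul_le_of_le_one_right (inv_pos.2 hy).le hx

/-- On a set of the critical measure `e` cannot be approximated by `V` better than `1 / y`. -/
theorem inv_le_of_approx [PreconnectedSpace X] (h : IsLeadingTerm μ V e) {y r : ℝ} (hy : 1 ≤ y)
    {Q : Set X} (hQ : μ.real Q = μ.real Set.univ - leastSuperlevel μ V e y)
    {g : C(X, ℝ)} (hg : g ∈ V) (hr : ∀ x ∈ Q, |e x - g x| ≤ r) : y⁻¹ ≤ r := by
  by_contra! hlt
  have hy0 : 0 < y := one_pos.trans_le hy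
  -- The maximum with 0 makes t positive without any assumption on the sign of r; 1/t > y is the new
  -- leading coefficient.
  obtain ⟨t, ht, hty⟩ := exists_between (max_lt hlt (inv_pos.2 hy0))
  have ht0 : 0 < t := (le_max_right _ _).trans_lt ht
  have hyt : y < t⁻¹ := (lt_inv_comm₀ ht0 hy0).1 hty
  have hV : (-t⁻¹) • g ∈ V := V.smul_mem _ hg
  have h1 := superlevel_add_sublevel μ (h.null_level (inv_pos.2 ht0).ne' hV 1)
  have h2 : μ.real Q ≤ μ.real {x | |(t⁻¹ • e + (-t⁻¹) • g) x| ≤ 1} := by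
    refine measureReal_mono fun x hx => ?_
    have heq : (t⁻¹ • e + (-t⁻¹) • g) x = t⁻¹ * (e x - g x) := by
      simp only [ContinuousMap.add_apply, ContinuousMap.smul_apply, smul_eq_mul]
      ring
    change |(t⁻¹ • e + (-t⁻¹) • g) x| ≤ 1
    rw [heq, abs_mul, abs_of_pos (inv_pos.2 ht0), inv_mul_le_one₀ ht0]
    exact (hr x hx).trans ((le_max_left _ _).trans ht.le)
  have h3 := leastSuperlevel_le μ e t⁻¹ hV
  have h4 := h.leastSuperlevel_strictMono hy hyt
  linarith

end IsLeadingTerm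

/-! ### Trigonometric polynomials on the torus -/

/-- A continuous `2π`-periodic function as a function on the torus. -/
noncomputable def torusLift (f : ℝ → ℝ) (hf : Continuous f) (hp : Function.Periodic f (2 * Real.pi)) :
    C(Torus, ℝ) :=
  ⟨hp.lift, hf.quotient_liftOn' _⟩

theorem periodic_cos_nat_mul (k : ℕ) :
    Function.Periodic (fun t => Real.cos (k * t)) (2 * Real.pi) := fun t => by
  simp only [mul_add, Real.cos_add_nat_mul_two_pi]

theorem periodic_sin_nat_mul (k : ℕ) :
    Function.Periodic (fun t => Real.sin (k * t)) (2 * Real.pi) := fun t => by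
  simp only [mul_add, Real.sin_add_nat_mul_two_pi]

/-- `cos kt` on the torus. -/
noncomputable def cosMap (k : ℕ) : C(Torus, ℝ) :=
  torusLift (fun t => Real.cos (k * t)) (by fun_prop) (periodic_cos_nat_mul k)

/-- `sin kt` on the torus. -/
noncomputable def sinMap (k : ℕ) : C(Torus, ℝ) :=
  torusLift (fun t => Real.sin (k * t)) (by fun_prop) (periodic_sin_nat_mul k)

@[simp] theorem cosMap_coe (k : ℕ) (t : ℝ) : cosMap k t = Real.cos (k * t) := rfl

@[simp] theorem sinMap_coe (k : ℕ) (t : ℝ) : sinMap k t = Real.sin (k * t) := rfl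

/-- `trigPoly m a b` on the torus. -/
noncomputable def trigMap (m : ℕ) (a b : ℕ → ℝ) : C(Torus, ℝ) :=
  (a 0 / 2) • 1 + ∑ k ∈ Finset.Icc 1 m, (a k • cosMap k + b k • sinMap k)

theorem trigMap_coe (m : ℕ) (a b : ℕ → ℝ) (t : ℝ) : trigMap m a b t = trigPoly m a b t := by
  simp [trigMap, trigPoly, ContinuousMap.sum_apply]

theorem Torus.ext_coe {f g : C(Torus, ℝ)} (h : ∀ t : ℝ, f t = g t) : f = g := by
  ext x
  obtain ⟨t, rfl⟩ := QuotientAddGroup.mk_surjective x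
  exact h t

/-- The trigonometric polynomials of order `m`, as functions on the torus. -/
noncomputable def trigSpace (m : ℕ) : Submodule ℝ C(Torus, ℝ) where
  carrier := {f | ∃ a b, f = trigMap m a b}
  zero_mem' := ⟨0, 0, by simp [trigMap]⟩
  add_mem' := by
    rintro _ _ ⟨a, b, rfl⟩ ⟨a', b', rfl⟩
    refine ⟨a + a', b + b', ?_⟩
    simp only [trigMap, Pi.add_apply, add_div, add_smul, Finset.sum_add_distrib]
    abel
  smul_mem' := by
    rintro c _ ⟨a, b, rfl⟩
    refine ⟨c • a, c • b, ?_⟩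
    simp only [trigMap, Pi.smul_apply, smul_eq_mul, mul_div_assoc, mul_smul, Finset.smul_sum,
      smul_add]

theorem trigMap_mem (m : ℕ) (a b : ℕ → ℝ) : trigMap m a b ∈ trigSpace m := ⟨a, b, rfl⟩

instance (m : ℕ) : FiniteDimensional ℝ (trigSpace m) := by
  let s : Set C(Torus, ℝ) := {1} ∪ (cosMap '' Finset.Icc 1 m ∪ sinMap '' Finset.Icc 1 m)
  have hs : s.Finite := (Set.finite_singleton _).union
    (((Finset.finite_toSet _).image _).union ((Finset.finite_toSet _).image _))
  have := FiniteDimensional.span_of_finite ℝ hs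
  refine Submodule.finiteDimensional_of_le (S₂ := Submodule.span ℝ s) ?_
  rintro _ ⟨a, b, rfl⟩
  refine add_mem (Submodule.smul_mem _ _ (Submodule.subset_span (Or.inl rfl)))
    (sum_mem fun k hk => add_mem (Submodule.smul_mem _ _ (Submodule.subset_span ?_))
      (Submodule.smul_mem _ _ (Submodule.subset_span ?_)))
  · exact Or.inr (Or.inl ⟨k, hk, rfl⟩)
  · exact Or.inr (Or.inr ⟨k, hk, rfl⟩)

theorem sum_exp_eq_zero {n j : ℕ} (hj : 0 < j) (hjn : j < 2 * n) :
    ∑ k ∈ Finset.range (2 * n), Complex.exp ((j * (k * Real.pi / n) : ℝ) * Complex.I) = 0 := by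
  have hn : (n : ℂ) ≠ 0 := Nat.cast_ne_zero.2 (by omega)
  have hζ := Complex.isPrimitiveRoot_exp (2 * n) (by omega)
  set ζ := Complex.exp (2 * Real.pi * Complex.I / (2 * n : ℕ)) with hζdef
  have h1 : ∀ k ∈ Finset.range (2 * n),
      Complex.exp ((j * (k * Real.pi / n) : ℝ) * Complex.I) = (ζ ^ j) ^ k := by
    intro k _
    rw [← pow_mul, hζdef, ← Complex.exp_nat_mul]
    congr 1
    push_cast
    field_simp
  rw [Finset.sum_congr rfl h1]
  have h2 := mul_geom_sum (ζ ^ j) (2 * n)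
  rw [← pow_mul, mul_comm j, pow_mul, hζ.pow_eq_one, one_pow, sub_self] at h2
  exact (mul_eq_zero.1 h2).resolve_left
    (sub_ne_zero.2 (hζ.pow_ne_one_of_pos_of_lt hj.ne' hjn))

theorem sum_cos_eq_zero {n j : ℕ} (hj : 0 < j) (hjn : j < 2 * n) :
    ∑ k ∈ Finset.range (2 * n), Real.cos (j * (k * Real.pi / n)) = 0 := by
  have := congrArg Complex.re (sum_exp_eq_zero hj hjn)
  simpa only [Complex.re_sum, Complex.exp_ofReal_mul_I_re, Complex.zero_re] using this

theorem sum_sin_eq_zero {n j : ℕ} (hj : 0 < j) (hjn : j < 2 * n) :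
    ∑ k ∈ Finset.range (2 * n), Real.sin (j * (k * Real.pi / n)) = 0 := by
  have := congrArg Complex.im (sum_exp_eq_zero hj hjn)
  simpa only [Complex.im_sum, Complex.exp_ofReal_mul_I_im, Complex.zero_im] using this

/-- At the nodes kπ/n the sign (-1)^k shifts the frequency from j to j + n, which lies strictly
between 0 and 2n. -/
theorem sum_alternating_cos {n j : ℕ} (hj : j < n) :
    ∑ k ∈ Finset.range (2 * n), (-1 : ℝ) ^ k * Real.cos (j * (k * Real.pi / n)) = 0 := by
  rw [← sum_cos_eq_zero (n := n) (j := j + n) (by omega) (by omega)]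
  refine Finset.sum_congr rfl fun k _ => ?_
  rw [← Real.cos_add_nat_mul_pi]
  have : (n : ℝ) ≠ 0 := Nat.cast_ne_zero.2 (by omega)
  congr 1
  push_cast
  field_simp

theorem sum_alternating_sin {n j : ℕ} (hj : j < n) :
    ∑ k ∈ Finset.range (2 * n), (-1 : ℝ) ^ k * Real.sin (j * (k * Real.pi / n)) = 0 := by
  rw [← sum_sin_eq_zero (n := n) (j := j + n) (by omega) (by omega)]
  refine Finset.sum_congr rfl fun k _ => ?_
  rw [← Real.sin_add_nat_mul_pi]
  have : (n : ℝ) ≠ 0 := Nat.cast_ne_zero.2 (by omega)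
  congr 1
  push_cast
  field_simp

/-- The alternating sum over the extremal points of `cos nt` annihilates lower orders. -/
theorem sum_alternating_trigMap {n : ℕ} (hn : 1 ≤ n) (a b : ℕ → ℝ) :
    ∑ k ∈ Finset.range (2 * n),
      (-1 : ℝ) ^ k * trigMap (n - 1) a b ((k * Real.pi / n : ℝ) : Torus) = 0 := by
  simp only [trigMap_coe, trigPoly, mul_add, Finset.mul_sum, Finset.sum_add_distrib]
  have h0 := sum_alternating_cos (n := n) (j := 0) (by omega)
  simp only [Nat.cast_zero, zero_mul, Real.cos_zero, mul_one] at h0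
  rw [← Finset.sum_mul, h0, zero_mul, zero_add, Finset.sum_comm,
    Finset.sum_comm (s := Finset.range (2 * n)), Finset.sum_eq_zero, Finset.sum_eq_zero, add_zero]
  · intro j hj
    have hj := Finset.mem_Icc.1 hj
    simp only [mul_left_comm _ (b j), ← Finset.mul_sum]
    rw [sum_alternating_sin (by omega), mul_zero]
  · intro j hj
    have hj := Finset.mem_Icc.1 hj
    simp only [mul_left_comm _ (a j), ← Finset.mul_sum]
    rw [sum_alternating_cos (by omega), mul_zero]

/-- The alternating sum over the 2n extremal points of cos nt kills g and returns 2ny, while each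
term is at most the norm. -/
theorem abs_le_norm_smul_cosMap_add {n : ℕ} (hn : 1 ≤ n) (y : ℝ) {g : C(Torus, ℝ)}
    (hg : g ∈ trigSpace (n - 1)) : |y| ≤ ‖y • cosMap n + g‖ := by
  obtain ⟨a, b, rfl⟩ := hg
  have hn' : (n : ℝ) ≠ 0 := Nat.cast_ne_zero.2 (by omega)
  set f := y • cosMap n + trigMap (n - 1) a b with hf
  have hsum : ∑ k ∈ Finset.range (2 * n), (-1 : ℝ) ^ k * f ((k * Real.pi / n : ℝ) : Torus) =
      2 * n * y := by
    simp only [hf, ContinuousMap.add_apply, mul_add, Finset.sum_add_distrib,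
      sum_alternating_trigMap hn, add_zero]
    rw [Finset.sum_congr rfl (g := fun _ => y)]
    · simp
    · intro k _
      rw [ContinuousMap.smul_apply, cosMap_coe, mul_div_cancel₀ _ hn', Real.cos_nat_mul_pi,
        smul_eq_mul, mul_left_comm, ← mul_pow]
      simp
  have hle : |2 * n * y| ≤ 2 * n * ‖f‖ := by
    rw [← hsum]
    refine (Finset.abs_sum_le_sum_abs _ _).trans ?_
    refine (Finset.sum_le_card_nsmul _ _ ‖f‖ fun k _ => ?_).trans (by simp)
    rw [abs_mul, abs_pow, abs_neg, abs_one, one_pow, one_mul]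
    exact f.norm_coe_le_norm _
  rw [abs_mul, abs_of_nonneg (by positivity : (0 : ℝ) ≤ 2 * n)] at hle
  exact le_of_mul_le_mul_left hle (by positivity)

theorem contDiff_trigPoly (m : ℕ) (a b : ℕ → ℝ) : ContDiff ℝ ω (trigPoly m a b) := by
  unfold trigPoly
  refine contDiff_const.add (ContDiff.sum fun k _ => ?_)
  exact (contDiff_const.mul (Real.contDiff_cos.comp (contDiff_const.mul contDiff_id))).add
    (contDiff_const.mul (Real.contDiff_sin.comp (contDiff_const.mul contDiff_id)))

/-- A nonzero function on the torus with analytic lift has a null zero set. -/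
theorem volume_zeros_of_analytic {f : C(Torus, ℝ)} (hf : AnalyticOnNhd ℝ (fun t : ℝ => f t) Set.univ)
    (h0 : f ≠ 0) : volume {x | f x = 0} = 0 := by
  have hnull : ∀ᵐ t : ℝ, f t ≠ 0 := by
    rcases hf.eqOn_zero_or_eventually_ne_zero_of_preconnected isPreconnected_univ with h | h
    · exact absurd (Torus.ext_coe fun t => h (Set.mem_univ t)) h0
    · have := ae_restrict_le_codiscreteWithin (μ := volume) MeasurableSet.univ h
      rwa [Measure.restrict_univ] at this
  have hmp := AddCircle.measurePreserving_mk (2 * Real.pi) 0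
  have hm : MeasurableSet {x | f x = 0} := (isClosed_eq f.continuous continuous_const).measurableSet
  rw [← hmp.measure_preimage hm.nullMeasurableSet]
  refine measure_mono_null_ae ?_ (measure_empty (μ := volume.restrict _))
  filter_upwards [ae_restrict_of_ae hnull] with t ht hmem
  exact ht hmem

theorem isLeadingTerm_cosMap {n : ℕ} (hn : 1 ≤ n) :
    IsLeadingTerm volume (trigSpace (n - 1)) (cosMap n) where
  one_mem := by
    -- The coefficient is 2 because the constant term is a₀/2.
    refine ⟨Pi.single 0 2, 0, Torus.ext_coe fun t => ?_⟩
    rw [trigMap_coe, trigPoly, Finset.sum_eq_zero]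
    · simp
    · intro k hk
      have hk : k ≠ 0 := by have := Finset.mem_Icc.1 hk; omega
      simp [Pi.single_eq_of_ne hk]
  abs_le_one x := by
    obtain ⟨t, rfl⟩ := QuotientAddGroup.mk_surjective x
    exact Real.abs_cos_le_one _
  exists_zero := ⟨((Real.pi / 2 / n : ℝ) : Torus), by
    rw [cosMap_coe, mul_div_cancel₀ _ (Nat.cast_ne_zero.2 (by omega)), Real.cos_pi_div_two]⟩
  abs_coeff_le y g hg := abs_le_norm_smul_cosMap_add hn y hg
  null_zeros := by
    rintro y _ ⟨a, b, rfl⟩ h0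
    refine volume_zeros_of_analytic ?_ h0
    have : (fun t : ℝ => (y • cosMap n + trigMap (n - 1) a b) (t : Torus)) =
        fun t => y * Real.cos (n * t) + trigPoly (n - 1) a b t := by
      ext t
      simp [trigMap_coe]
    rw [this]
    refine ContDiff.analyticOnNhd (ContDiff.add ?_ (contDiff_trigPoly _ a b))
    exact contDiff_const.mul (Real.contDiff_cos.comp (contDiff_const.mul contDiff_id))

/-! ### Transfer to the concrete definitions -/

theorem levelMeasure_coe (f : C(Torus, ℝ)) :
    levelMeasure (fun t => f t) = superlevel volume 1 f := by
  have : {x : Torus | ∃ t : ℝ, (t : Torus) = x ∧ 1 ≤ |f t|} = {x | 1 ≤ |f x|} := by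
    ext x
    constructor
    · rintro ⟨t, rfl, h⟩
      exact h
    · intro h
      obtain ⟨t, rfl⟩ := QuotientAddGroup.mk_surjective x
      exact ⟨t, rfl, h⟩
  rw [levelMeasure, this, superlevel]

theorem mem_trigPolys_iff {m : ℕ} {f : ℝ → ℝ} :
    f ∈ trigPolys m ↔ ∃ g ∈ trigSpace m, f = fun t : ℝ => g t := by
  constructor
  · rintro ⟨a, b, rfl⟩
    exact ⟨_, trigMap_mem m a b, funext fun t => (trigMap_coe m a b t).symm⟩
  · rintro ⟨_, ⟨a, b, rfl⟩, rfl⟩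
    exact ⟨a, b, funext fun t => trigMap_coe m a b t⟩

theorem sigmaDev_eq (n : ℕ) (y : ℝ) :
    sigmaDev n y = leastSuperlevel volume (trigSpace (n - 1)) (cosMap n) y := by
  rw [sigmaDev, leastSuperlevel]
  congr 1
  ext s
  constructor
  · rintro ⟨_, ⟨_, hg, rfl⟩, rfl⟩
    obtain ⟨g, hg', rfl⟩ := mem_trigPolys_iff.1 hg
    exact ⟨g, hg', levelMeasure_coe (y • cosMap n + g)⟩
  · rintro ⟨g, hg, rfl⟩
    exact ⟨_, ⟨_, mem_trigPolys_iff.2 ⟨g, hg, rfl⟩, rfl⟩, (levelMeasure_coe (y • cosMap n + g)).symm⟩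

theorem supNormOn_nonneg (Q : Set Torus) (f : ℝ → ℝ) : 0 ≤ supNormOn Q f :=
  Real.sSup_nonneg (by rintro _ ⟨t, -, rfl⟩; exact abs_nonneg _)

theorem abs_le_supNormOn {Q : Set Torus} (f : C(Torus, ℝ)) {x : Torus} (hx : x ∈ Q) :
    |f x| ≤ supNormOn Q (fun t => f t) := by
  obtain ⟨t, rfl⟩ := QuotientAddGroup.mk_surjective x
  refine le_csSup ⟨‖f‖, ?_⟩ ⟨t, hx, rfl⟩
  rintro _ ⟨s, -, rfl⟩
  exact f.norm_coe_le_norm _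

theorem bestApprox_nonneg (n : ℕ) (Q : Set Torus) : 0 ≤ bestApprox n Q :=
  Real.sInf_nonneg (by rintro _ ⟨g, -, rfl⟩; exact supNormOn_nonneg _ _)

theorem bestApprox_le {n : ℕ} {Q : Set Torus} {r : ℝ} (hr : 0 ≤ r) {g : C(Torus, ℝ)}
    (hg : g ∈ trigSpace (n - 1)) (h : ∀ x ∈ Q, |cosMap n x - g x| ≤ r) : bestApprox n Q ≤ r := by
  refine le_trans (csInf_le ⟨0, ?_⟩ ⟨_, mem_trigPolys_iff.2 ⟨g, hg, rfl⟩, rfl⟩) ?_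
  · rintro _ ⟨g, -, rfl⟩
    exact supNormOn_nonneg _ _
  -- Nonnegativity of r covers empty Q, where the supremum defaults to 0.
  · refine Real.sSup_le ?_ hr
    rintro _ ⟨t, ht, rfl⟩
    exact h t ht

theorem le_bestApprox {n : ℕ} {Q : Set Torus} {r : ℝ}
    (h : ∀ g ∈ trigSpace (n - 1), ∀ s, (∀ x ∈ Q, |cosMap n x - g x| ≤ s) → r ≤ s) :
    r ≤ bestApprox n Q := by
  refine le_csInf ⟨_, _, mem_trigPolys_iff.2 ⟨0, Submodule.zero_mem _, rfl⟩, rfl⟩ ?_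
  rintro _ ⟨_, hg, rfl⟩
  obtain ⟨g, hg', rfl⟩ := mem_trigPolys_iff.1 hg
  exact h g hg' _ fun x hx => abs_le_supNormOn (cosMap n - g) hx

theorem corollary3 (n : ℕ) (hn : 1 ≤ n) :
    (∀ y α : ℝ, 1 < y → 2 * α = 2 * Real.pi - sigmaDev n y →
      0 < α ∧ α < Real.pi ∧ leastUniformDev n (2 * α) = y⁻¹) ∧
    (∀ α : ℝ, 0 < α → α < Real.pi →
      ∃ y : ℝ, 1 < y ∧ 2 * α = 2 * Real.pi - sigmaDev n y) := by
  have h := isLeadingTerm_cosMap hn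
  have huniv : (volume : Measure Torus).real Set.univ = 2 * Real.pi := by
    rw [measureReal_def, AddCircle.measure_univ, ENNReal.toReal_ofReal Real.two_pi_pos.le]
  refine ⟨fun y α hy hα => ?_, fun α h0 hπ => ?_⟩
  · rw [sigmaDev_eq] at hα
    have hy0 : 0 < y := one_pos.trans hy
    have hlt := h.leastSuperlevel_lt y
    have hpos := h.leastSuperlevel_pos hy
    rw [huniv] at hlt
    refine ⟨by linarith, by linarith, ?_⟩
    obtain ⟨Q, hQ, hQm, g, hg, happ⟩ := h.exists_isCompact_approx hy0
    rw [huniv, ← hα] at hQm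
    refine le_antisymm ?_ (le_csInf ⟨_, Q, hQ, hQm, rfl⟩ ?_)
    · refine le_trans (csInf_le ⟨0, ?_⟩ ⟨Q, hQ, hQm, rfl⟩)
        (bestApprox_le (inv_pos.2 hy0).le hg happ)
      rintro _ ⟨Q', -, -, rfl⟩
      exact bestApprox_nonneg _ _
    · rintro _ ⟨Q', -, hQ', rfl⟩
      exact le_bestApprox fun g hg s hs =>
        h.inv_le_of_approx hy.le (by rw [hQ', hα, huniv]) hg hs
  · obtain ⟨y, hy, hys⟩ := h.exists_leastSuperlevel_eq (s := 2 * Real.pi - 2 * α)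
      (by linarith) (by rw [huniv]; linarith)
    exact ⟨y, hy, by rw [sigmaDev_eq, hys]; ring⟩
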